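/- Let $\mathcal H$ be a complex Hilbert space of finite or countably infinite dimension, let $\mathcal L(\mathcal H)$ be the space of bounded linear operators on $\mathcal H$ and $\mathcal T(\mathcal H)\subseteq\mathcal L(\mathcal H)$ the space of trace class operators. A state is a positive operator $\xi\in\mathcal T(\mathcal H)$ with $\operatorname{tr}\xi=1$. For a completely positive linear map $\Phi:\mathcal T(\mathcal H)\to\mathcal T(\mathcal H)$, the adjoint map $\Phi^*$ on $\mathcal L(\mathcal H)$ is defined by $\operatorname{tr}(X\,\Phi(Y))=\operatorname{tr}(\Phi^*(X)\,Y)$ for all $X\in\mathcal L(\mathcal H)$, $Y\in\mathcal T(\mathcal H)$. Let $E\in\mathcal L(\mathcal H)$ be a nonzero effect, i.e. $0\le E\le \mathbb 1$ and $E\neq 0$. The following conditions are equivalent: (i) $E$ is rank-1, that is, $E=eP$ for some one-dimensional orthogonal projection $P$ and some number $0<e\le 1$. (ii) Every completely positive linear map $\Phi:\mathcal T(\mathcal H)\to\mathcal T(\mathcal H)$ with $\Phi^*(\mathbb 1)=E$ is of the form $$\Phi(\varrho)=\operatorname{tr}(\varrho E)\,\xi\qquad\text{for all }\varrho\in\mathcal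 T(\mathcal H),$$ for some state $\xi$ (depending on $\Phi$). -/

import Mathlib

open scoped ComplexOrder InnerProductSpace

namespace QOp

section

variable (H : Type*) [NormedAddCommGroup H] [InnerProductSpace ℂ H] [CompleteSpace H]

/-- A reference orthonormal (Hilbert) basis of `H`, indexed by a subset of `H`. The notions below
that are computed in it (finite trace of a positive operator, trace of a trace class operator) do
not depend on which basis is used. -/
noncomputable def refBasis : HilbertBasis (exists_hilbertBasis ℂ H).choose ℂ H :=
  (exists_hilbertBasis ℂ H).choose_spec.choose

end

section

variable {H : Type*} [NormedAddCommGroup H] [InnerProductSpace ℂ H] [CompleteSpace H]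

/-- The trace `∑ᵢ ⟨eᵢ, T eᵢ⟩` of a bounded operator. It is the usual trace when `T` is trace class,
and is only used for such `T`. -/
noncomputable def tr (T : H →L[ℂ] H) : ℂ :=
  ∑' i, ⟪refBasis H i, T (refBasis H i)⟫_ℂ

/-- A positive operator with finite trace `∑ᵢ ⟨eᵢ, A eᵢ⟩ < ∞`. -/
def IsPosFiniteTrace (A : H →L[ℂ] H) : Prop :=
  0 ≤ A ∧ Summable fun i => ⟪refBasis H i, A (refBasis H i)⟫_ℂ

variable (H) in
/-- The space of trace class operators on `H`: the complex linear span, inside the bounded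
operators, of the positive operators with finite trace. -/
def TraceClass : Submodule ℂ (H →L[ℂ] H) :=
  Submodule.span ℂ {A | IsPosFiniteTrace A}

/-- A state (density operator): a positive trace class operator of trace one. -/
def IsState (ξ : TraceClass H) : Prop :=
  0 ≤ (ξ : H →L[ℂ] H) ∧ tr (ξ : H →L[ℂ] H) = 1

/-- An effect: a bounded operator `E` with `0 ≤ E ≤ 1`. -/
def IsEffect (E : H →L[ℂ] H) : Prop :=
  0 ≤ E ∧ E ≤ 1

/-- `E` is rank-1: `E = e P` with `P` a one-dimensional orthogonal projection and `0 < e ≤ 1`. -/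
def IsRankOne (E : H →L[ℂ] H) : Prop :=
  ∃ (P : H →L[ℂ] H) (e : ℝ), IsStarProjection P ∧
    Module.finrank ℂ (LinearMap.range (P : H →ₗ[ℂ] H)) = 1 ∧ 0 < e ∧ e ≤ 1 ∧ E = (e : ℂ) • P

/-- Positivity of the operator on the `n`-fold direct sum `H ⊕ ⋯ ⊕ H` that is given by an
`n × n` matrix of bounded operators: its quadratic form takes values in `[0, ∞)`. -/
def IsPosBlock {n : ℕ} (M : Matrix (Fin n) (Fin n) (H →L[ℂ] H)) : Prop :=
  ∀ x : Fin n → H, 0 ≤ ∑ i, ∑ j, ⟪x i, M i j (x j)⟫_ℂ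

/-- A linear map on the trace class is completely positive if, for each `n`, applying it to all
entries of an `n × n` matrix of trace class operators preserves positivity. -/
def IsCompletelyPositive (Φ : TraceClass H →ₗ[ℂ] TraceClass H) : Prop :=
  ∀ (n : ℕ) (M : Matrix (Fin n) (Fin n) (TraceClass H)),
    IsPosBlock (M.map fun T => (T : H →L[ℂ] H)) →
      IsPosBlock (M.map fun T => (Φ T : H →L[ℂ] H))

/-- `Z = Φ*(X)`, where the adjoint map `Φ*` on the bounded operators is defined by trace duality:
`tr (X Φ(Y)) = tr (Z Y)` for all trace class `Y`. -/
def IsAdjointValue (Φ : TraceClass H →ₗ[ℂ] TraceClass H) (X Z : H →L[ℂ] H) : Prop :=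
  ∀ Y : TraceClass H, tr (X * (Φ Y : H →L[ℂ] H)) = tr (Z * (Y : H →L[ℂ] H))

end

end QOp

/-!
Suppose that `E = e |u⟩⟨u|` with `u` a unit vector, and put `P = |u⟩⟨u|`, `Q = 1 - P`. For
positive `Y` the image of `Q Y Q` under `Φ` is positive with trace `tr (E Q Y Q) = 0`, so it
vanishes. As `Φ` maps the positive operators `(P + z Q) Y (P + z Q)*`, `z ∈ ℂ`, to positive
operators, it vanishes on `P Y Q` and `Q Y P` too (`QOp.map_eq_smul_of_nonneg`). Hence
`Φ Y = Φ (P Y P) = ⟪u, Y u⟫ Φ P`, and `ξ = e⁻¹ Φ P` is the required state. Only positivity of `Φ`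
enters here.

Conversely, let `S = √E`. The Lüders map `Y ↦ S Y S` is completely positive, and its adjoint takes
`1` to `S² = E` by cyclicity of the trace (`QOp.summable_and_tr_sandwich`). If it has the form
`Y ↦ tr (Y E) ξ`, then all the operators `|S x⟩⟨S x|` are multiples of `ξ`, so the range of `S` is a
line (`QOp.exists_unit_of_sandwich`) and `E` has rank one.

That `Y ↦ S Y S` maps the trace class to itself, and that the trace is cyclic, rests on writing a
positive trace class operator as `√Y √Y` with `√Y` Hilbert–Schmidt. All sums are taken in the fixed
reference basis, so independence of the trace from the basis is never used.
-/

open ContinuousLinearMap InnerProductSpace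

namespace QOp

variable {H : Type*} [NormedAddCommGroup H] [InnerProductSpace ℂ H] [CompleteSpace H]

/-! ### Hilbert–Schmidt operators and cyclicity of the trace -/

/-- A bounded operator `T` with `∑ᵢ ‖T eᵢ‖² < ∞` in the reference basis. -/
def IsHilbertSchmidt (T : H →L[ℂ] H) : Prop :=
  Summable fun i => ‖T (refBasis H i)‖ ^ 2

/-- Parseval's identity. -/
theorem hasSum_norm_inner_refBasis_sq (x : H) :
    HasSum (fun j => ‖⟪refBasis H j, x⟫_ℂ‖ ^ 2) (‖x‖ ^ 2) := by
  have h := (refBasis H).hasSum_inner_mul_inner x x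
  have h' := Complex.hasSum_re h
  convert h' using 1
  · ext j
    rw [← inner_conj_symm x, Complex.conj_mul', ← Complex.ofReal_pow, Complex.ofReal_re]
  · rw [inner_self_eq_norm_sq_to_K]
    norm_cast

theorem isHilbertSchmidt_iff_summable_prod (T : H →L[ℂ] H) :
    IsHilbertSchmidt T ↔
      Summable fun p : _ × _ => ‖⟪refBasis H p.2, T (refBasis H p.1)⟫_ℂ‖ ^ 2 := by
  rw [summable_prod_of_nonneg fun _ => by positivity]
  simp only [fun x => (hasSum_norm_inner_refBasis_sq (H := H) x).tsum_eq]
  exact ⟨fun h => ⟨fun i => (hasSum_norm_inner_refBasis_sq _).summable, h⟩, fun h => h.2⟩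

theorem IsHilbertSchmidt.star {T : H →L[ℂ] H} (hT : IsHilbertSchmidt T) :
    IsHilbertSchmidt (star T) := by
  rw [isHilbertSchmidt_iff_summable_prod] at hT ⊢
  convert (Equiv.prodComm _ _).summable_iff.mpr hT using 2 with p
  simp only [Function.comp, Equiv.prodComm_apply, Prod.fst_swap, Prod.snd_swap]
  rw [star_eq_adjoint, adjoint_inner_right, ← inner_conj_symm, RCLike.norm_conj]

theorem IsHilbertSchmidt.mul_left {T : H →L[ℂ] H} (hT : IsHilbertSchmidt T) (A : H →L[ℂ] H) :
    IsHilbertSchmidt (A * T) := by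
  refine Summable.of_nonneg_of_le (fun i => by positivity) (fun i => ?_)
    (Summable.mul_left (‖A‖ ^ 2) hT)
  rw [← mul_pow]
  exact pow_le_pow_left₀ (norm_nonneg _) (A.le_opNorm _) 2

theorem IsHilbertSchmidt.mul_right {T : H →L[ℂ] H} (hT : IsHilbertSchmidt T) (A : H →L[ℂ] H) :
    IsHilbertSchmidt (T * A) := by
  simpa using (hT.star.mul_left (Star.star A)).star

section Cyclic

variable {A B : H →L[ℂ] H}

theorem hasSum_inner_mul_apply (A B : H →L[ℂ] H) (x : H) :
    HasSum (fun j => ⟪x, A (refBasis H j)⟫_ℂ * ⟪refBasis H j, B x⟫_ℂ) ⟪x, (A * B) x⟫_ℂ := by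
  simpa [adjoint_inner_left] using
    (refBasis H).hasSum_inner_mul_inner (adjoint A x) (B x)

theorem IsHilbertSchmidt.summable_prod (hA : IsHilbertSchmidt A) (hB : IsHilbertSchmidt B) :
    Summable fun p : _ × _ => ⟪refBasis H p.1, A (refBasis H p.2)⟫_ℂ *
      ⟪refBasis H p.2, B (refBasis H p.1)⟫_ℂ := by
  rw [isHilbertSchmidt_iff_summable_prod] at hA hB
  refine Summable.of_norm_bounded ((Equiv.prodComm _ _).summable_iff.mpr hA |>.add hB) fun p => ?_
  simp only [Function.comp, Equiv.prodComm_apply, Prod.fst_swap, Prod.snd_swap, norm_mul]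
  nlinarith [two_mul_le_add_sq ‖⟪refBasis H p.1, A (refBasis H p.2)⟫_ℂ‖
    ‖⟪refBasis H p.2, B (refBasis H p.1)⟫_ℂ‖, norm_nonneg ⟪refBasis H p.1, A (refBasis H p.2)⟫_ℂ,
    norm_nonneg ⟪refBasis H p.2, B (refBasis H p.1)⟫_ℂ,
    sq_nonneg ‖⟪refBasis H p.1, A (refBasis H p.2)⟫_ℂ‖,
    sq_nonneg ‖⟪refBasis H p.2, B (refBasis H p.1)⟫_ℂ‖]

theorem IsHilbertSchmidt.summable_inner_mul (hA : IsHilbertSchmidt A) (hB : IsHilbertSchmidt B) :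
    Summable fun i => ⟪refBasis H i, (A * B) (refBasis H i)⟫_ℂ := by
  have h := (hA.summable_prod hB).hasSum.prod_fiberwise
    (g := fun i => ⟪refBasis H i, (A * B) (refBasis H i)⟫_ℂ) fun i =>
      hasSum_inner_mul_apply A B (refBasis H i)
  exact h.summable

/-- Both traces are sums of the same absolutely summable double family, by rows and by columns. -/
theorem IsHilbertSchmidt.tr_mul_comm (hA : IsHilbertSchmidt A) (hB : IsHilbertSchmidt B) :
    tr (A * B) = tr (B * A) := by
  have hs := hA.summable_prod hB
  have h₁ := hs.hasSum.prod_fiberwise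
    (g := fun i => ⟪refBasis H i, (A * B) (refBasis H i)⟫_ℂ) fun i =>
      hasSum_inner_mul_apply A B (refBasis H i)
  have h₂ := ((Equiv.prodComm _ _).hasSum_iff.mpr hs.hasSum).prod_fiberwise
    (g := fun i => ⟪refBasis H i, (B * A) (refBasis H i)⟫_ℂ) fun j => by
      simpa [mul_comm] using hasSum_inner_mul_apply B A (refBasis H j)
  rw [tr, tr, h₁.tsum_eq, h₂.tsum_eq]

end Cyclic

/-! ### Positive operators and the trace class -/

theorem nonneg_iff_forall_inner {G : Type*} [NormedAddCommGroup G] [InnerProductSpace ℂ G]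
    {A : G →L[ℂ] G} : 0 ≤ A ↔ ∀ x, 0 ≤ ⟪x, A x⟫_ℂ := by
  rw [nonneg_iff_isPositive]
  refine ⟨fun h x => h.inner_nonneg_right x, fun h => ?_⟩
  rw [isPositive_iff_complex]
  intro x
  have hx := Complex.nonneg_iff.mp (h x)
  have hc : ⟪A x, x⟫_ℂ = ⟪x, A x⟫_ℂ := by
    rw [← inner_conj_symm, Complex.conj_eq_iff_im]
    exact hx.2.symm
  rw [hc]
  exact ⟨Complex.ext rfl hx.2, hx.1⟩

theorem conj_nonneg {A : H →L[ℂ] H} (hA : 0 ≤ A) (B : H →L[ℂ] H) : 0 ≤ B * A * star B := by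
  rw [nonneg_iff_forall_inner] at hA ⊢
  intro x
  simpa [star_eq_adjoint, adjoint_inner_left] using hA (star B x)

theorem isSelfAdjoint_sqrt (A : H →L[ℂ] H) : star (CFC.sqrt A) = CFC.sqrt A :=
  (IsSelfAdjoint.of_nonneg (CFC.sqrt_nonneg A)).star_eq

theorem inner_eq_norm_sqrt_sq {A : H →L[ℂ] H} (hA : 0 ≤ A) (x : H) :
    ⟪x, A x⟫_ℂ = ((‖CFC.sqrt A x‖ ^ 2 : ℝ) : ℂ) := by
  have h : A = adjoint (CFC.sqrt A) * CFC.sqrt A := by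
    rw [← star_eq_adjoint, isSelfAdjoint_sqrt, CFC.sqrt_mul_sqrt_self A hA]
  conv_lhs => rw [h]
  rw [mul_apply_eq_comp, adjoint_inner_right, inner_self_eq_norm_sq_to_K]
  norm_cast

theorem isPosFiniteTrace_iff {A : H →L[ℂ] H} :
    IsPosFiniteTrace A ↔ 0 ≤ A ∧ IsHilbertSchmidt (CFC.sqrt A) := by
  refine and_congr_right fun hA => ?_
  simp only [inner_eq_norm_sqrt_sq hA, IsHilbertSchmidt]
  exact Complex.summable_ofReal

theorem IsPosFiniteTrace.conj {A : H →L[ℂ] H} (hA : IsPosFiniteTrace A) (B : H →L[ℂ] H) :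
    IsPosFiniteTrace (B * A * star B) := by
  obtain ⟨h0, hs⟩ := isPosFiniteTrace_iff.mp hA
  refine ⟨conj_nonneg h0 B, ?_⟩
  have := (hs.mul_left B).summable_inner_mul (hs.mul_right (star B))
  rwa [mul_assoc B, ← mul_assoc (CFC.sqrt A), CFC.sqrt_mul_sqrt_self A h0, ← mul_assoc] at this

/-- The trace class is a two-sided ideal. The positive generators are handled by the polarization
identity `4 A Y B* = ∑ₖ iᵏ (A + iᵏ B) Y (A + iᵏ B)*`. -/
theorem mul_mul_mem_traceClass (A B : H →L[ℂ] H) {Y : H →L[ℂ] H} (hY : Y ∈ TraceClass H) :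
    A * Y * B ∈ TraceClass H := by
  induction hY using Submodule.span_induction with
  | zero => simp
  | add X Y _ _ hX hY => rw [mul_add, add_mul]; exact add_mem hX hY
  | smul c X _ hX => rw [mul_smul_comm, smul_mul_assoc]; exact Submodule.smul_mem _ _ hX
  | mem Y hY =>
    have hmem (C : H →L[ℂ] H) : C * Y * star C ∈ TraceClass H :=
      Submodule.subset_span (IsPosFiniteTrace.conj hY C)
    have key : A * Y * B = (1 / 4 : ℂ) • ((A + star B) * Y * star (A + star B)
        - (A - star B) * Y * star (A - star B)
        + Complex.I • ((A + Complex.I • star B) * Y * star (A + Complex.I • star B))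
        - Complex.I • ((A - Complex.I • star B) * Y * star (A - Complex.I • star B))) := by
      simp only [star_add, star_sub, star_smul, star_star, add_mul, mul_add, sub_mul, mul_sub,
        smul_mul_assoc, mul_smul_comm, RCLike.star_def, Complex.conj_I]
      match_scalars <;> ring_nf <;> simp
      norm_num
    rw [key]
    exact Submodule.smul_mem _ _ <| sub_mem (add_mem (sub_mem (hmem _) (hmem _))
      (Submodule.smul_mem _ _ (hmem _))) (Submodule.smul_mem _ _ (hmem _))

/-- The map `Y ↦ A Y B` on the trace class. -/
noncomputable def sandwich (A B : H →L[ℂ] H) : TraceClass H →ₗ[ℂ] TraceClass H :=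
  (LinearMap.mulRight ℂ B ∘ₗ LinearMap.mulLeft ℂ A).restrict
    fun _ hY => mul_mul_mem_traceClass A B hY

@[simp]
theorem coe_sandwich (A B : H →L[ℂ] H) (Y : TraceClass H) :
    (sandwich A B Y : H →L[ℂ] H) = A * Y * B := rfl

/-- `tr (S Y S) = tr (S² Y)`; for positive `Y` this is cyclicity of the trace for the
Hilbert–Schmidt operators `S √Y` and `√Y S`. The summability claims make both traces additive,
so that the identity passes to the linear span. -/
theorem summable_and_tr_sandwich (S : H →L[ℂ] H) {Y : H →L[ℂ] H} (hY : Y ∈ TraceClass H) :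
    (Summable fun i => ⟪refBasis H i, (S * Y * S) (refBasis H i)⟫_ℂ) ∧
      (Summable fun i => ⟪refBasis H i, (S * S * Y) (refBasis H i)⟫_ℂ) ∧
      tr (S * Y * S) = tr (S * S * Y) := by
  induction hY using Submodule.span_induction with
  | zero => simp [summable_zero]
  | add X Y _ _ hX hY =>
    obtain ⟨hX₁, hX₂, hX₃⟩ := hX
    obtain ⟨hY₁, hY₂, hY₃⟩ := hY
    simp only [tr] at hX₃ hY₃ ⊢
    simp only [mul_add, add_mul, add_apply, inner_add_right]
    exact ⟨hX₁.add hY₁, hX₂.add hY₂, by rw [hX₁.tsum_add hY₁, hX₂.tsum_add hY₂, hX₃, hY₃]⟩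
  | smul c X _ hX =>
    obtain ⟨hX₁, hX₂, hX₃⟩ := hX
    simp only [tr] at hX₃ ⊢
    simp only [mul_smul_comm, smul_mul_assoc, smul_apply, inner_smul_right]
    exact ⟨hX₁.mul_left c, hX₂.mul_left c, by rw [tsum_mul_left, tsum_mul_left, hX₃]⟩
  | mem Y hY =>
    obtain ⟨h0, hs⟩ := isPosFiniteTrace_iff.mp hY
    have e₁ : S * Y * S = (S * CFC.sqrt Y) * (CFC.sqrt Y * S) := by
      conv_lhs => rw [← CFC.sqrt_mul_sqrt_self Y h0]
      simp only [mul_assoc]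
    have e₂ : S * S * Y = (S * S * CFC.sqrt Y) * CFC.sqrt Y := by
      conv_lhs => rw [← CFC.sqrt_mul_sqrt_self Y h0]
      simp only [mul_assoc]
    rw [e₁, e₂]
    refine ⟨(hs.mul_left S).summable_inner_mul (hs.mul_right S),
      (hs.mul_left (S * S)).summable_inner_mul hs, ?_⟩
    rw [(hs.mul_left S).tr_mul_comm (hs.mul_right S), (hs.mul_left (S * S)).tr_mul_comm hs]
    simp only [mul_assoc]

theorem tr_smul (c : ℂ) (A : H →L[ℂ] H) : tr (c • A) = c * tr A := by
  simp [tr, tsum_mul_left]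

theorem hasSum_inner_rankOne (x y : H) :
    HasSum (fun i => ⟪refBasis H i, rankOne ℂ x y (refBasis H i)⟫_ℂ) ⟪y, x⟫_ℂ := by
  simpa [inner_smul_right] using (refBasis H).hasSum_inner_mul_inner y x

theorem tr_rankOne (x y : H) : tr (rankOne ℂ x y) = ⟪y, x⟫_ℂ :=
  (hasSum_inner_rankOne x y).tsum_eq

theorem isPosFiniteTrace_rankOne_self (x : H) : IsPosFiniteTrace (rankOne ℂ x x) :=
  ⟨(nonneg_iff_isPositive _).mpr (isPositive_rankOne_self x), (hasSum_inner_rankOne x x).summable⟩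

theorem tr_rankOne_mul (x y : H) (Y : H →L[ℂ] H) : tr (rankOne ℂ x y * Y) = ⟪y, Y x⟫_ℂ := by
  have h : rankOne ℂ x y * Y = rankOne ℂ x (adjoint Y y) := by
    ext z
    simp [adjoint_inner_left]
  rw [h, tr_rankOne, adjoint_inner_left]

theorem tr_mul_rankOne (x y : H) (Y : H →L[ℂ] H) : tr (Y * rankOne ℂ x y) = ⟪y, Y x⟫_ℂ := by
  have h : Y * rankOne ℂ x y = rankOne ℂ (Y x) y := by
    ext z
    simp
  rw [h, tr_rankOne]

/-- Faithfulness of the trace on positive trace class operators. Nonnegativity of the terms alone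
would not do, as a divergent sum is `0` by convention. -/
theorem eq_zero_of_tr_eq_zero {A : H →L[ℂ] H} (hA : 0 ≤ A) (hA' : A ∈ TraceClass H)
    (h : tr A = 0) : A = 0 := by
  have hs : Summable fun i => ‖CFC.sqrt A (refBasis H i)‖ ^ 2 := by
    simpa [inner_eq_norm_sqrt_sq hA, ← Complex.ofReal_pow, Complex.summable_ofReal] using
      (summable_and_tr_sandwich 1 hA').1
  have h0 : ∑' i, ‖CFC.sqrt A (refBasis H i)‖ ^ 2 = 0 := by
    rw [tr] at h
    simp only [inner_eq_norm_sqrt_sq hA] at h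
    rw [← Complex.ofReal_tsum] at h
    exact_mod_cast h
  have hz := (hs.hasSum_iff.mpr h0)
  rw [hasSum_zero_iff_of_nonneg fun i => by positivity] at hz
  have hsq : CFC.sqrt A = 0 := by
    refine ContinuousLinearMap.ext_on (s := Set.range (refBasis H)) ?_ ?_
    · rw [dense_iff_closure_eq, ← Submodule.topologicalClosure_coe, (refBasis H).dense_span]
      rfl
    · rintro _ ⟨i, rfl⟩
      simpa using congrFun hz i
  rw [← CFC.sqrt_mul_sqrt_self A hA, hsq, mul_zero]

/-! ### Rank-one effects -/

/-- A self-adjoint operator whose range lies in the line of a unit vector `u`. -/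
theorem eq_smul_rankOne_of_range {A : H →L[ℂ] H} (hA : star A = A) {u : H} (hu : ‖u‖ = 1)
    (h : ∀ x, ∃ c : ℂ, A x = c • u) : A = ⟪u, A u⟫_ℂ • rankOne ℂ u u := by
  have huu : ⟪u, u⟫_ℂ = 1 := by simp [inner_self_eq_norm_sq_to_K, hu]
  have hx (x : H) : A x = ⟪u, A x⟫_ℂ • u := by
    obtain ⟨c, hc⟩ := h x
    rw [hc, inner_smul_right, huu, mul_one]
  have hsymm (x y : H) : ⟪x, A y⟫_ℂ = ⟪A x, y⟫_ℂ := by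
    rw [← adjoint_inner_left, ← star_eq_adjoint, hA]
  ext x
  have hc : ⟪A u, u⟫_ℂ = ⟪u, A u⟫_ℂ := (hsymm u u).symm
  rw [hx x, hsymm, hx u, inner_smul_left, inner_conj_symm, hc]
  simp [hu, mul_smul]

theorem IsRankOne.exists_unit {E : H →L[ℂ] H} (hE : IsRankOne E) :
    ∃ (u : H) (e : ℝ), ‖u‖ = 1 ∧ 0 < e ∧ E = (e : ℂ) • rankOne ℂ u u := by
  obtain ⟨P, e, hP, hrank, he, -, rfl⟩ := hE
  obtain ⟨⟨v, w, hw⟩, hv0, hv⟩ := finrank_eq_one_iff'.mp hrank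
  have hv0' : v ≠ 0 := fun h => hv0 (Subtype.ext h)
  have hn : (‖v‖ : ℂ) ≠ 0 := by simpa using hv0'
  have hu : ‖((‖v‖ : ℂ)⁻¹ • v)‖ = 1 := by
    rw [norm_smul, norm_inv, Complex.norm_real, norm_norm]
    exact inv_mul_cancel₀ (norm_ne_zero_iff.mpr hv0')
  have hPv : P v = v := by
    have hw' : P w = v := hw
    rw [← hw', ← mul_apply_eq_comp, hP.isIdempotentElem.eq]
  refine ⟨(‖v‖ : ℂ)⁻¹ • v, e, hu, he, ?_⟩
  congr 1
  have h := eq_smul_rankOne_of_range hP.isSelfAdjoint.star_eq hu fun x => by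
    obtain ⟨c, hc⟩ := hv ⟨P x, x, rfl⟩
    refine ⟨c * ‖v‖, ?_⟩
    rw [smul_smul, mul_assoc, mul_inv_cancel₀ hn, mul_one]
    exact (congrArg Subtype.val hc).symm
  rw [h, map_smul, hPv, inner_self_eq_norm_sq_to_K, hu]
  simp

theorem isRankOne_of_range {E : H →L[ℂ] H} (hE : IsEffect E) (hE0 : E ≠ 0) {u : H} (hu : ‖u‖ = 1)
    (h : ∀ x, ∃ c : ℂ, E x = c • u) : IsRankOne E := by
  have hEq := eq_smul_rankOne_of_range (IsSelfAdjoint.of_nonneg hE.1).star_eq hu h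
  have h0 := nonneg_iff_forall_inner.mp hE.1 u
  have h1 : ⟪u, E u⟫_ℂ ≤ 1 := by
    have := nonneg_iff_forall_inner.mp (sub_nonneg.mpr hE.2) u
    simpa [inner_sub_right, hu] using this
  obtain ⟨hre, him⟩ := Complex.nonneg_iff.mp h0
  have hr : ((⟪u, E u⟫_ℂ).re : ℂ) = ⟪u, E u⟫_ℂ := Complex.ext rfl him
  have hu0 : u ≠ 0 := by
    rintro rfl
    simp at hu
  refine ⟨rankOne ℂ u u, (⟪u, E u⟫_ℂ).re, isStarProjection_rankOne_self hu, ?_,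
    lt_of_le_of_ne hre fun hz => hE0 ?_, (Complex.le_def.mp h1).1, by rw [hr]; exact hEq⟩
  · have hrange : LinearMap.range (rankOne ℂ u u : H →ₗ[ℂ] H) = ℂ ∙ u := by
      refine le_antisymm ?_ ?_
      · rintro _ ⟨x, rfl⟩
        exact Submodule.smul_mem _ _ (Submodule.mem_span_singleton_self u)
      · rw [Submodule.span_singleton_le_iff_mem]
        exact ⟨u, by simp [hu]⟩
    rw [hrange, finrank_span_singleton hu0]
  · rw [hEq, ← hr, ← hz]
    simp

/-! ### Maps whose adjoint value at the identity has rank one -/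

/-- A real-affine function of `z ∈ ℂ` that is real-valued and bounded below is constant. -/
theorem eq_zero_of_forall_nonneg {a b c : ℂ}
    (h : ∀ z : ℂ, 0 ≤ a + star z * b + z * c) : b = 0 ∧ c = 0 := by
  have h' (z : ℂ) := Complex.nonneg_iff.mp (h z)
  have h0 := (h' 0).2
  have h1 := (h' 1).2
  have hI := (h' Complex.I).2
  simp at h0 h1 hI
  have hc : c = star b := Complex.ext (by simp; linarith) (by simp; linarith)
  have hb : b = 0 := by
    by_contra hb
    have hpos : 0 < Complex.normSq b := Complex.normSq_pos.mpr hb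
    -- Reality forces `c` to be the conjugate of `b`, so `z = -t b` gives the value `a - 2 t |b|²`.
    obtain ⟨t, ht⟩ : ∃ t : ℝ, a.re - 2 * t * Complex.normSq b < 0 :=
      ⟨(a.re + 1) / (2 * Complex.normSq b), by field_simp; linarith⟩
    have := (h' (-(t : ℂ) * b)).1
    rw [hc] at this
    simp [Complex.normSq_apply] at this ht
    nlinarith
  exact ⟨hb, by simp [hc, hb]⟩

theorem IsCompletelyPositive.map_nonneg {Φ : TraceClass H →ₗ[ℂ] TraceClass H}
    (hΦ : IsCompletelyPositive Φ) {Y : TraceClass H} (hY : 0 ≤ (Y : H →L[ℂ] H)) :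
    0 ≤ (Φ Y : H →L[ℂ] H) := by
  rw [nonneg_iff_forall_inner] at hY ⊢
  intro x
  -- This is the definition for `1 × 1` matrices.
  simpa [Matrix.map] using
    hΦ 1 (fun _ _ => Y) (fun x => by simpa [Matrix.map] using hY (x 0)) fun _ => x

/-- With `P` the projection onto the unit vector `u` and `Q = 1 - P`, the positive operators
`(P + z Q) Y (P + z Q)*` are mapped to positive operators. Their `Q Y Q` part is mapped to `0`,
having trace `e ⟪u, Q Y Q u⟫ = 0` after mapping, and what remains is affine in `z`; so the
off-diagonal parts are mapped to `0` as well. -/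
theorem map_eq_smul_of_nonneg {Φ : TraceClass H →ₗ[ℂ] TraceClass H}
    (hpos : ∀ Y : TraceClass H, 0 ≤ (Y : H →L[ℂ] H) → 0 ≤ (Φ Y : H →L[ℂ] H))
    {u : H} (hu : ‖u‖ = 1) {e : ℂ} (hadj : IsAdjointValue Φ 1 (e • rankOne ℂ u u))
    {Y : TraceClass H} (hY : 0 ≤ (Y : H →L[ℂ] H)) (hR : rankOne ℂ u u ∈ TraceClass H) :
    Φ Y = ⟪u, (Y : H →L[ℂ] H) u⟫_ℂ • Φ ⟨rankOne ℂ u u, hR⟩ := by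
  obtain ⟨P, hPdef⟩ : ∃ P, P = rankOne ℂ u u := ⟨_, rfl⟩
  have hPs : star P = P := hPdef ▸ (isStarProjection_rankOne_self hu).isSelfAdjoint.star_eq
  obtain ⟨Q, hQdef⟩ : ∃ Q, Q = 1 - P := ⟨_, rfl⟩
  have hQs : star Q = Q := by rw [hQdef, star_sub, star_one, hPs]
  have hQu : Q u = 0 := by simp [hQdef, hPdef, hu]
  have hQQ : Φ (sandwich Q Q Y) = 0 := by
    have h0 : 0 ≤ (sandwich Q Q Y : H →L[ℂ] H) := by
      have := conj_nonneg hY Q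
      rwa [hQs] at this
    refine Subtype.ext (eq_zero_of_tr_eq_zero (hpos _ h0) (Φ _).2 ?_)
    have := hadj (sandwich Q Q Y)
    rw [one_mul, smul_mul_assoc, tr_smul, tr_rankOne_mul] at this
    rw [this]
    simp [hQu]
  have hexp (z : ℂ) : 0 ≤ (Φ (sandwich P P Y) + star z • Φ (sandwich P Q Y)
      + z • Φ (sandwich Q P Y) : H →L[ℂ] H) := by
    have key : sandwich (P + z • Q) (star (P + z • Q)) Y = sandwich P P Y
        + star z • sandwich P Q Y + z • sandwich Q P Y + (z * star z) • sandwich Q Q Y := by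
      apply Subtype.ext
      simp only [Submodule.coe_add, Submodule.coe_smul, coe_sandwich, star_add, star_smul, hPs,
        hQs, add_mul, mul_add, smul_mul_assoc, mul_smul_comm]
      module
    have := hpos _ (show 0 ≤ (sandwich (P + z • Q) (star (P + z • Q)) Y : H →L[ℂ] H) from
      conj_nonneg hY _)
    rw [key] at this
    simpa [hQQ] using this
  have hoff (x : H) := eq_zero_of_forall_nonneg fun z => by
    simpa [inner_add_right, inner_smul_right] using nonneg_iff_forall_inner.mp (hexp z) x
  have hext {Z : TraceClass H} (h : ∀ x, ⟪x, (Z : H →L[ℂ] H) x⟫_ℂ = 0) : Z = 0 := by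
    have := (inner_map_self_eq_zero ((Z : H →L[ℂ] H) : H →ₗ[ℂ] H)).mp fun x => by
      rw [← inner_conj_symm]
      simp [h x]
    exact Subtype.ext (ContinuousLinearMap.coe_injective this)
  have hPQ := hext fun x => (hoff x).1
  have hQP := hext fun x => (hoff x).2
  have hdecomp : Y = sandwich P P Y + sandwich P Q Y + sandwich Q P Y + sandwich Q Q Y := by
    apply Subtype.ext
    simp only [Submodule.coe_add, coe_sandwich, hQdef]
    noncomm_ring
  have hPP : sandwich P P Y = ⟪u, (Y : H →L[ℂ] H) u⟫_ℂ • ⟨rankOne ℂ u u, hR⟩ := by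
    apply Subtype.ext
    ext x
    simp [hPdef, smul_smul, mul_comm]
  conv_lhs => rw [hdecomp]
  rw [map_add, map_add, map_add, hPQ, hQP, hQQ, hPP, map_smul]
  simp

theorem exists_state_of_isRankOne {E : H →L[ℂ] H} (hE : IsRankOne E)
    {Φ : TraceClass H →ₗ[ℂ] TraceClass H} (hΦ : IsCompletelyPositive Φ)
    (hadj : IsAdjointValue Φ 1 E) :
    ∃ ξ : TraceClass H, IsState ξ ∧ ∀ ρ : TraceClass H, Φ ρ = tr ((ρ : H →L[ℂ] H) * E) • ξ := by
  obtain ⟨u, e, hu, he, rfl⟩ := hE.exists_unit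
  have he0 : (e : ℂ) ≠ 0 := by exact_mod_cast he.ne'
  have hpf := isPosFiniteTrace_rankOne_self u
  have hR : rankOne ℂ u u ∈ TraceClass H := Submodule.subset_span hpf
  refine ⟨(e : ℂ)⁻¹ • Φ ⟨rankOne ℂ u u, hR⟩, ⟨?_, ?_⟩, ?_⟩
  · have h := hΦ.map_nonneg (Y := ⟨rankOne ℂ u u, hR⟩) hpf.1
    have hinv : (0 : ℂ) ≤ (e : ℂ)⁻¹ := by
      rw [← Complex.ofReal_inv]
      exact_mod_cast inv_nonneg.mpr he.le
    rw [nonneg_iff_forall_inner] at h ⊢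
    intro x
    simpa [inner_smul_right] using mul_nonneg hinv (h x)
  · have h := hadj ⟨rankOne ℂ u u, hR⟩
    rw [one_mul, smul_mul_assoc, tr_smul, tr_rankOne_mul] at h
    rw [Submodule.coe_smul, tr_smul, h]
    simp [hu, he0]
  · rintro ⟨ρ, hρ⟩
    have htr (Y : H →L[ℂ] H) : tr (Y * ((e : ℂ) • rankOne ℂ u u)) = e * ⟪u, Y u⟫_ℂ := by
      rw [mul_smul_comm, tr_smul, tr_mul_rankOne]
    simp only [htr, smul_smul, mul_right_comm (e : ℂ), mul_inv_cancel₀ he0, one_mul]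
    induction hρ using Submodule.span_induction with
    | zero =>
      have h : (⟨0, Submodule.zero_mem _⟩ : TraceClass H) = 0 := rfl
      rw [h, map_zero]
      simp
    | mem Y hY => exact map_eq_smul_of_nonneg (fun _ => hΦ.map_nonneg) hu hadj hY.1 hR
    | add X Y hX hY ihX ihY =>
      have h : (⟨X + Y, add_mem hX hY⟩ : TraceClass H) = ⟨X, hX⟩ + ⟨Y, hY⟩ := rfl
      rw [h, map_add, ihX, ihY, add_apply, inner_add_right, add_smul]
    | smul c X hX ihX =>
      have h : (⟨c • X, Submodule.smul_mem _ c hX⟩ : TraceClass H) = c • ⟨X, hX⟩ := rfl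
      rw [h, map_smul, ihX, smul_apply, inner_smul_right, smul_smul]

/-! ### The Lüders map -/

theorem isCompletelyPositive_sandwich {S : H →L[ℂ] H} (hS : star S = S) :
    IsCompletelyPositive (sandwich S S) := by
  intro n M hM x
  refine (hM fun i => S (x i)).trans_eq ?_
  refine Finset.sum_congr rfl fun i _ => Finset.sum_congr rfl fun j _ => ?_
  conv_lhs => rw [← hS]
  rw [star_eq_adjoint, adjoint_inner_left, ← star_eq_adjoint, hS]
  rfl

theorem isAdjointValue_sandwich (S : H →L[ℂ] H) : IsAdjointValue (sandwich S S) 1 (S * S) := by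
  intro Y
  rw [one_mul]
  exact (summable_and_tr_sandwich S Y.2).2.2

/-- If `Y ↦ S Y S` has one-dimensional range then so does `S`: the images `|S x⟩⟨S x|` of the
operators `|x⟩⟨x|` are then multiples of each other. -/
theorem exists_unit_of_sandwich {S : H →L[ℂ] H} (hS : star S = S) (hS0 : S ≠ 0)
    {f : TraceClass H → ℂ} {ξ : TraceClass H} (h : ∀ Y, sandwich S S Y = f Y • ξ) :
    ∃ u : H, ‖u‖ = 1 ∧ ∀ x, ∃ c : ℂ, S x = c • u := by
  have hrank (x : H) : ∃ c : ℂ, rankOne ℂ (S x) (S x) = c • (ξ : H →L[ℂ] H) := by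
    have := congrArg Subtype.val
      (h ⟨rankOne ℂ x x, Submodule.subset_span (isPosFiniteTrace_rankOne_self x)⟩)
    refine ⟨_, Eq.trans ?_ this⟩
    ext z
    have hz : ⟪S x, z⟫_ℂ = ⟪x, S z⟫_ℂ := by
      conv_rhs => rw [← hS]
      rw [star_eq_adjoint, adjoint_inner_right]
    simp [hz]
  obtain ⟨x₀, hx₀⟩ : ∃ x, S x ≠ 0 := by
    by_contra! hcon
    exact hS0 (ContinuousLinearMap.ext hcon)
  obtain ⟨c₀, hc₀⟩ := hrank x₀
  have hc₀0 : c₀ ≠ 0 := by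
    rintro rfl
    rw [zero_smul] at hc₀
    exact rankOne_ne_zero (𝕜 := ℂ) hx₀ hx₀ hc₀
  have hn : (‖S x₀‖ : ℂ) ≠ 0 := by simpa using hx₀
  refine ⟨(‖S x₀‖ : ℂ)⁻¹ • S x₀, ?_, fun x => ?_⟩
  · rw [norm_smul, norm_inv, Complex.norm_real, norm_norm]
    exact inv_mul_cancel₀ (norm_ne_zero_iff.mpr hx₀)
  · suffices ∃ c : ℂ, S x = c • S x₀ by
      obtain ⟨c, hc⟩ := this
      exact ⟨c * ‖S x₀‖, by rw [smul_smul, mul_assoc, mul_inv_cancel₀ hn, mul_one, hc]⟩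
    by_cases hx : S x = 0
    · exact ⟨0, by simp [hx]⟩
    obtain ⟨c, hc⟩ := hrank x
    have hxx : ⟪S x, S x⟫_ℂ ≠ 0 := inner_self_ne_zero.mpr hx
    have e₁ : rankOne ℂ (S x) (S x) = (c * c₀⁻¹) • rankOne ℂ (S x₀) (S x₀) := by
      rw [hc, hc₀, smul_smul, mul_assoc, inv_mul_cancel₀ hc₀0, mul_one]
    have e₂ : ⟪S x, S x⟫_ℂ • S x = (c * c₀⁻¹) • ⟪S x₀, S x⟫_ℂ • S x₀ :=
      congrArg (fun T : H →L[ℂ] H => T (S x)) e₁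
    refine ⟨(⟪S x, S x⟫_ℂ)⁻¹ * ((c * c₀⁻¹) * ⟪S x₀, S x⟫_ℂ), ?_⟩
    rw [mul_smul, mul_smul, ← e₂, smul_smul, inv_mul_cancel₀ hxx, one_smul]

end QOp

theorem proposition3p7 {H : Type*} [NormedAddCommGroup H] [InnerProductSpace ℂ H]
    [CompleteSpace H] [TopologicalSpace.SeparableSpace H]
    (E : H →L[ℂ] H) (hE : QOp.IsEffect E) (hE0 : E ≠ 0) :
    QOp.IsRankOne E ↔
      ∀ Φ : QOp.TraceClass H →ₗ[ℂ] QOp.TraceClass H,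
        QOp.IsCompletelyPositive Φ → QOp.IsAdjointValue Φ 1 E →
          ∃ ξ : QOp.TraceClass H, QOp.IsState ξ ∧
            ∀ ρ : QOp.TraceClass H, Φ ρ = QOp.tr ((ρ : H →L[ℂ] H) * E) • ξ := by
  refine ⟨fun h Φ hΦ hadj => QOp.exists_state_of_isRankOne h hΦ hadj, fun h => ?_⟩
  have hS := QOp.isSelfAdjoint_sqrt E
  have hSS := CFC.sqrt_mul_sqrt_self E hE.1
  have hadj := QOp.isAdjointValue_sandwich (CFC.sqrt E)
  rw [hSS] at hadj
  obtain ⟨ξ, -, hξ⟩ := h _ (QOp.isCompletelyPositive_sandwich hS) hadj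
  have hS0 : CFC.sqrt E ≠ 0 := fun h0 => hE0 (by rw [← hSS, h0, mul_zero])
  obtain ⟨u, hu, hr⟩ := QOp.exists_unit_of_sandwich hS hS0 hξ
  refine QOp.isRankOne_of_range hE hE0 hu fun x => ?_
  rw [← hSS]
  exact hr _
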